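/- Let $n\ge 0$ and let $\mathbb{Q}\langle X_n\rangle=\mathbb{Q}\langle x_1,\dots,x_n\rangle$ be the algebra of polynomials in $n$ noncommuting variables, graded by degree, with the symmetric group $\mathfrak{S}_n$ acting by permuting the variables. For a variable $x$, let $\partial_x$ be the Hausdorff derivative: the linear operator sending a word $w$ to the sum, over all occurrences of the letter $x$ in $w$, of the word obtained from $w$ by deleting that occurrence. Let $$\mathcal{A}'_n=\bigcap_{i=1}^n\ker\partial_{x_i}\subseteq\mathbb{Q}\langle X_n\rangle ,$$ a graded $\mathfrak{S}_n$-submodule of $\mathbb{Q}\langle X_n\rangle$ with finite-dimensional homogeneous components $(\mathcal{A}'_n)_k$. Let $\mathit{Sym}=\mathbb{Q}[[q]][p_1,p_2,\dots]$ be the ring of symmetric functions, $p_k$ being the power sums, let $h_m$ be the complete homogeneous symmetric functions, and write $h_{(n-d,1^d)}=h_{n-d}h_1^d$. For $f\in\mathit{Sym}$ let $f[X(1-q)]$ be the image of $f$ under the $\mathbb{Q}[[q]]$-algebra endomorphism $p_k\mapsto(1-q^k)p_k$, and put $\{q;q\}_d=(1-q)(1-2q)\cdots(1-dq)$. Define the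 graded Frobenius characteristic by $$\mathrm{Frob}_{\mathfrak{S}_n}(\mathcal{A}'_n)=\frac1{n!}\sum_{\sigma\in\mathfrak{S}_n}\Big(\sum_{k\ge0}\mathrm{tr}\big(\sigma|_{(\mathcal{A}'_n)_k}\big)q^k\Big)p_{\lambda(\sigma)},$$ where $\lambda(\sigma)$ is the cycle type of $\sigma$. Then $$\mathrm{Frob}_{\mathfrak{S}_n}(\mathcal{A}'_n)=\sum_{d=0}^n\frac{q^d}{\{q;q\}_d}\,h_{(n-d,1^d)}[X(1-q)].$$ -/

import Mathlib

noncomputable section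

namespace NCHarmonics

/-! ### Symmetric functions -/

/-- The ring of symmetric functions `Sym = R[p₁, p₂, p₃, …]` with coefficients in the ring
`R = ℚ⟦q⟧` of formal power series in `q`: polynomials in the power sums. -/
abbrev SymFn : Type := MvPolynomial ℕ+ (PowerSeries ℚ)

/-- The power sum symmetric function `p_k`, for `k ≥ 1`. -/
def p (k : ℕ) : SymFn := MvPolynomial.X k.toPNat'

/-- The power sum symmetric function `p_μ = ∏ p_{μ_i}` of a partition `μ`. -/
def pPart {m : ℕ} (μ : m.Partition) : SymFn := (μ.parts.map p).prod

/-- `z_μ = ∏_i n_i(μ)! i^{n_i(μ)}`, where `n_i(μ)` is the number of parts of `μ` of size `i`. -/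
def z {m : ℕ} (μ : m.Partition) : ℕ :=
  ∏ i ∈ μ.parts.toFinset, (μ.parts.count i).factorial * i ^ μ.parts.count i

/-- The complete homogeneous symmetric function `h_m = ∑_{μ ⊢ m} p_μ / z_μ`, written in the power
sums (see `eval_h` for the comparison with complete homogeneous polynomials). -/
def h (m : ℕ) : SymFn := ∑ μ : m.Partition, ((z μ : ℚ)⁻¹) • pPart μ

lemma z_cons {m m' : ℕ} (k : ℕ) (ν : m.Partition) (μ : m'.Partition)
    (hμ : μ.parts = k ::ₘ ν.parts) : z μ = k * (ν.parts.count k + 1) * z ν := by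
  have key : ∀ (s : Multiset ℕ) (F : Finset ℕ), s.toFinset ⊆ F →
      ∏ i ∈ s.toFinset, (s.count i).factorial * i ^ s.count i =
        ∏ i ∈ F, (s.count i).factorial * i ^ s.count i := by
    intro s F hF
    refine Finset.prod_subset hF fun i _ hi => ?_
    rw [Multiset.mem_toFinset] at hi
    simp [Multiset.count_eq_zero_of_notMem hi]
  have hF1 : (k ::ₘ ν.parts).toFinset ⊆ insert k ν.parts.toFinset := by simp
  have hF2 : ν.parts.toFinset ⊆ insert k ν.parts.toFinset := Finset.subset_insert _ _
  rw [z, z, hμ, key _ _ hF1, key _ _ hF2,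
    ← Finset.mul_prod_erase _ _ (Finset.mem_insert_self k ν.parts.toFinset),
    ← Finset.mul_prod_erase (insert k ν.parts.toFinset)
      (fun i => (ν.parts.count i).factorial * i ^ ν.parts.count i) (Finset.mem_insert_self k _)]
  have : ∀ i ∈ (insert k ν.parts.toFinset).erase k,
      ((k ::ₘ ν.parts).count i).factorial * i ^ (k ::ₘ ν.parts).count i =
        (ν.parts.count i).factorial * i ^ ν.parts.count i := by
    intro i hi
    rw [Multiset.count_cons_of_ne (Finset.ne_of_mem_erase hi)]
  rw [Finset.prod_congr rfl this, Multiset.count_cons_self, Nat.factorial_succ, pow_succ]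
  ring

lemma z_ne_zero {m : ℕ} (μ : m.Partition) : (z μ : ℚ) ≠ 0 := by
  rw [Nat.cast_ne_zero, z, Finset.prod_ne_zero_iff]
  intro i hi
  have := μ.parts_pos (Multiset.mem_toFinset.1 hi)
  positivity

lemma newton_h (m : ℕ) : (m : ℚ) • h m = ∑ k ∈ Finset.Icc 1 m, p k * h (m - k) := by
  have h1 : ∀ μ : m.Partition, (m : ℚ) • ((z μ : ℚ)⁻¹ • pPart μ) =
      ∑ k ∈ Finset.Icc 1 m, ((k * μ.parts.count k : ℕ) : ℚ) • ((z μ : ℚ)⁻¹ • pPart μ) := by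
    intro μ
    rw [← Finset.sum_smul, ← Nat.cast_sum]
    congr 2
    conv_lhs => rw [← μ.parts_sum, Finset.sum_multiset_count]
    rw [Finset.sum_subset (s₂ := Finset.Icc 1 m)]
    · exact Finset.sum_congr rfl fun i _ => by rw [smul_eq_mul, mul_comm]
    · intro i hi
      rw [Multiset.mem_toFinset] at hi
      exact Finset.mem_Icc.2 ⟨μ.parts_pos hi, μ.parts_sum ▸ Multiset.le_sum_of_mem hi⟩
    · intro i _ hi
      rw [Multiset.mem_toFinset] at hi
      simp [Multiset.count_eq_zero_of_notMem hi]
  rw [h, Finset.smul_sum, Finset.sum_congr rfl fun μ _ => h1 μ, Finset.sum_comm]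
  refine Finset.sum_congr rfl fun k hk => ?_
  obtain ⟨hk1, hkm⟩ := Finset.mem_Icc.1 hk
  rw [h, Finset.mul_sum]
  symm
  refine Finset.sum_of_injOn
    (fun ν : (m - k).Partition => (⟨k ::ₘ ν.parts,
      fun {i} hi => (Multiset.mem_cons.1 hi).elim (fun e => e ▸ hk1) ν.parts_pos,
      by rw [Multiset.sum_cons, ν.parts_sum]; omega⟩ : m.Partition)) ?_ ?_ ?_ ?_
  · intro ν _ ν' _ e
    have := congrArg Nat.Partition.parts e
    exact Nat.Partition.ext (by simpa using this)
  · intro _ _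
    simp
  · intro μ _ hμ
    have : k ∉ μ.parts := by
      intro hmem
      refine hμ ⟨⟨μ.parts.erase k, fun {i} hi => μ.parts_pos (Multiset.mem_of_mem_erase hi), ?_⟩,
        by simp, ?_⟩
      · have := congrArg Multiset.sum (Multiset.cons_erase hmem)
        rw [Multiset.sum_cons, μ.parts_sum] at this
        omega
      · exact Nat.Partition.ext (Multiset.cons_erase hmem)
    simp [Multiset.count_eq_zero_of_notMem this]
  · intro ν _
    have hz := z_cons (m' := m) k ν ⟨k ::ₘ ν.parts,
      fun {i} hi => (Multiset.mem_cons.1 hi).elim (fun e => e ▸ hk1) ν.parts_pos,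
      by rw [Multiset.sum_cons, ν.parts_sum]; omega⟩ rfl
    have hk0 : (k : ℚ) ≠ 0 := by exact_mod_cast (by omega : k ≠ 0)
    have hc : ((ν.parts.count k : ℚ) + 1) ≠ 0 := by positivity
    have hz0 := z_ne_zero ν
    simp only [hz, pPart, Multiset.map_cons, Multiset.prod_cons, Multiset.count_cons_self,
      smul_smul, mul_smul_comm]
    congr 1
    push_cast
    field_simp

lemma newton_hsymm (σ R : Type*) [Fintype σ] [DecidableEq σ] [CommRing R] (m : ℕ) :
    (m : MvPolynomial σ R) * MvPolynomial.hsymm σ R m =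
      ∑ k ∈ Finset.Icc 1 m, MvPolynomial.psum σ R k * MvPolynomial.hsymm σ R (m - k) := by
  have h1 : ∀ s : Sym σ m, (m : MvPolynomial σ R) * (s.1.map MvPolynomial.X).prod =
      ∑ k ∈ Finset.Icc 1 m, ∑ i : σ,
        if k ≤ s.1.count i then (s.1.map MvPolynomial.X).prod else 0 := by
    intro s
    rw [Finset.sum_comm]
    have h2 : ∀ i : σ, (∑ k ∈ Finset.Icc 1 m, if k ≤ s.1.count i then
        ((s.1.map MvPolynomial.X).prod : MvPolynomial σ R) else 0) =
        (s.1.count i : MvPolynomial σ R) * (s.1.map MvPolynomial.X).prod := by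
      intro i
      have hle : s.1.count i ≤ m := (Multiset.count_le_card i s.1).trans_eq s.2
      have hf : (Finset.Icc 1 m).filter (fun k => k ≤ s.1.count i) =
          Finset.Icc 1 (s.1.count i) := by
        ext k
        simp only [Finset.mem_filter, Finset.mem_Icc]
        omega
      rw [← Finset.sum_filter, hf, Finset.sum_const, Nat.card_Icc, nsmul_eq_mul]
      simp
    rw [Finset.sum_congr rfl fun i _ => h2 i, ← Finset.sum_mul, ← Nat.cast_sum,
      Multiset.sum_count_eq_card fun _ _ => Finset.mem_univ _]
    congr 2
    exact s.2.symm
  rw [MvPolynomial.hsymm, Finset.mul_sum, Finset.sum_congr rfl fun s _ => h1 s, Finset.sum_comm]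
  refine Finset.sum_congr rfl fun k hk => ?_
  obtain ⟨hk1, hkm⟩ := Finset.mem_Icc.1 hk
  rw [Finset.sum_comm, MvPolynomial.psum, Finset.sum_mul]
  refine Finset.sum_congr rfl fun i _ => ?_
  rw [MvPolynomial.hsymm, Finset.mul_sum]
  symm
  refine Finset.sum_of_injOn
    (fun s : Sym σ (m - k) => (⟨Multiset.replicate k i + s.1, by
      rw [Multiset.card_add, Multiset.card_replicate, s.2]; omega⟩ : Sym σ m)) ?_ ?_ ?_ ?_
  · intro s _ s' _ e
    have := congrArg Subtype.val e
    exact Subtype.ext (by simpa using this)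
  · intro _ _
    exact Finset.mem_coe.2 (Finset.mem_univ _)
  · intro s _ hs
    rw [if_neg]
    intro hle
    have hle' : Multiset.replicate k i ≤ s.1 := Multiset.le_count_iff_replicate_le.1 hle
    refine hs ⟨⟨s.1 - Multiset.replicate k i, ?_⟩, Finset.mem_coe.2 (Finset.mem_univ _), ?_⟩
    · rw [Multiset.card_sub hle', Multiset.card_replicate, s.2]
    · exact Subtype.ext (add_tsub_cancel_of_le hle')
  · intro s _
    simp [Multiset.count_add]

/-- In any finite set of variables, `h_m` specializes to the complete homogeneous symmetric
polynomial when each `p_k` is specialized to the power sum polynomial. -/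
theorem eval_h (σ : Type*) [Fintype σ] [DecidableEq σ] (m : ℕ) :
    MvPolynomial.aeval (fun k : ℕ+ => MvPolynomial.psum σ (PowerSeries ℚ) k) (h m) =
      MvPolynomial.hsymm σ (PowerSeries ℚ) m := by
  induction m using Nat.strong_induction_on with
  | _ m ih =>
    rcases Nat.eq_zero_or_pos m with rfl | hm
    · rw [h, Fintype.sum_unique, Unique.default_eq (Nat.Partition.indiscrete 0)]
      simp [z, pPart]
    · have e := congrArg
        (MvPolynomial.aeval (fun k : ℕ+ => MvPolynomial.psum σ (PowerSeries ℚ) k)) (newton_h m)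
      have e2 : ∑ k ∈ Finset.Icc 1 m,
          MvPolynomial.aeval (fun k : ℕ+ => MvPolynomial.psum σ (PowerSeries ℚ) k)
            (p k * h (m - k)) = ∑ k ∈ Finset.Icc 1 m, MvPolynomial.psum σ (PowerSeries ℚ) k *
              MvPolynomial.hsymm σ (PowerSeries ℚ) (m - k) := by
        refine Finset.sum_congr rfl fun k hk => ?_
        obtain ⟨hk1, hkm⟩ := Finset.mem_Icc.1 hk
        rw [map_mul, ih (m - k) (by omega), p, MvPolynomial.aeval_X]
        rw [Nat.toPNat'_coe, if_pos (by omega)]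
      rw [map_sum, e2, ← newton_hsymm, Nat.cast_smul_eq_nsmul, map_nsmul, nsmul_eq_mul] at e
      have : CharZero (MvPolynomial σ (PowerSeries ℚ)) := algebraRat.charZero _
      have hne : (m : MvPolynomial σ (PowerSeries ℚ)) ≠ 0 := Nat.cast_ne_zero.2 hm.ne'
      exact mul_left_cancel₀ hne e

/-- `h_(a₁, …, a_l) = h_{a₁} ⋯ h_{a_l}`. -/
def hList (a : List ℕ) : SymFn := (a.map h).prod

/-- The plethystic substitution `f ↦ f[X(1-q)]`: the `ℚ⟦q⟧`-algebra endomorphism of `Sym`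
sending `p_k` to `(1 - q^k) p_k` for every `k ≥ 1`. -/
def plethOneSubQ : SymFn →ₐ[PowerSeries ℚ] SymFn :=
  MvPolynomial.aeval fun k : ℕ+ =>
    MvPolynomial.C (1 - PowerSeries.X ^ (k : ℕ)) * MvPolynomial.X k

/-- `{q;q}_d = (1-q)(1-2q)⋯(1-dq)`. Its constant term is `1`, so it is invertible in `ℚ⟦q⟧`. -/
def braceQ (d : ℕ) : PowerSeries ℚ :=
  ∏ i ∈ Finset.Icc 1 d, (1 - (i : PowerSeries ℚ) * PowerSeries.X)

/-! ### Noncommutative polynomials -/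

/-- The noncommutative polynomials `ℚ⟨x₁, …, x_n⟩`: the algebra of the free monoid of words. -/
abbrev NCPoly (n : ℕ) : Type := MonoidAlgebra ℚ (FreeMonoid (Fin n))

/-- The canonical action of the symmetric group on `ℚ⟨X_n⟩` by permutation of the variables:
`σ · x_{i₁} ⋯ x_{i_r} = x_{σ(i₁)} ⋯ x_{σ(i_r)}`. -/
def permRep (n : ℕ) : Representation ℚ (Equiv.Perm (Fin n)) (NCPoly n) where
  toFun σ := MonoidAlgebra.mapDomainLinearMap ℚ ℚ (FreeMonoid.map σ)
  map_one' := by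
    ext w
    simp [Equiv.Perm.coe_one]
  map_mul' σ τ := by
    rw [Equiv.Perm.coe_mul, FreeMonoid.map_comp, MonoidHom.coe_comp,
      MonoidAlgebra.mapDomainLinearMap_comp]
    rfl

/-- The sum, over the occurrences of the letter `x` in the word `w`, of the word obtained from `w`
by deleting that occurrence. -/
def deleteSum {n : ℕ} (x : Fin n) (w : FreeMonoid (Fin n)) : NCPoly n :=
  ∑ i ∈ Finset.range w.toList.length,
    if w.toList[i]? = some x then
      MonoidAlgebra.single (FreeMonoid.ofList (w.toList.eraseIdx i)) 1
    else 0

/-- The Hausdorff derivative `∂_x`, the linear extension of `deleteSum x`. -/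
def hausdorff {n : ℕ} (x : Fin n) : NCPoly n →ₗ[ℚ] NCPoly n :=
  Finsupp.linearCombination ℚ (deleteSum x) ∘ₗ
    (MonoidAlgebra.coeffLinearEquiv ℚ).toLinearMap

lemma hausdorff_single {n : ℕ} (x : Fin n) (w : FreeMonoid (Fin n)) :
    hausdorff x (MonoidAlgebra.single w 1) = deleteSum x w := by
  simp [hausdorff]

lemma hausdorff_permRep {n : ℕ} (x : Fin n) (σ : Equiv.Perm (Fin n)) (f : NCPoly n) :
    hausdorff (σ x) (permRep n σ f) = permRep n σ (hausdorff x f) := by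
  suffices H : hausdorff (σ x) ∘ₗ permRep n σ = permRep n σ ∘ₗ hausdorff x from
    LinearMap.congr_fun H f
  refine (MonoidAlgebra.coeffLinearEquiv (M := FreeMonoid (Fin n)) (S := ℚ) ℚ).symm.arrowCongr
    (LinearEquiv.refl ℚ (NCPoly n)) |>.symm.injective ?_
  refine Finsupp.lhom_ext' fun w => LinearMap.ext_ring ?_
  change hausdorff (σ x) (permRep n σ (MonoidAlgebra.single w 1)) =
    permRep n σ (hausdorff x (MonoidAlgebra.single w 1))
  have hs : ∀ v : FreeMonoid (Fin n), permRep n σ (MonoidAlgebra.single v 1) =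
      MonoidAlgebra.single (FreeMonoid.map σ v) 1 := fun v => by simp [permRep]
  rw [hs, hausdorff_single, hausdorff_single, deleteSum, deleteSum, map_sum]
  simp only [FreeMonoid.toList_map, List.length_map, List.getElem?_map, apply_ite (permRep n σ),
    map_zero, hs]
  refine Finset.sum_congr rfl fun i _ => ?_
  congr 1
  · cases w.toList[i]? <;> simp
  · rw [← FreeMonoid.ofList_map, List.eraseIdx_map]

/-- The space `A'_n = ⋂_x ker ∂_x`, as a subrepresentation of `ℚ⟨X_n⟩`. -/
def derivedEnveloping (n : ℕ) : Subrepresentation (permRep n) where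
  toSubmodule := ⨅ x : Fin n, LinearMap.ker (hausdorff x)
  apply_mem_toSubmodule σ f hf := by
    simp only [Submodule.mem_iInf, LinearMap.mem_ker] at hf ⊢
    intro x
    have := hausdorff_permRep (σ⁻¹ x) σ f
    rw [hf, map_zero] at this
    simpa using this

/-- The noncommutative polynomials that are homogeneous of degree `k`, i.e. linear combinations of
words of length `k`, as a subrepresentation of `ℚ⟨X_n⟩`. -/
def homogeneousPart (n k : ℕ) : Subrepresentation (permRep n) where
  toSubmodule := MonoidAlgebra.supported ℚ ℚ {w | w.length = k}
  apply_mem_toSubmodule σ f hf := by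
    classical
    rw [MonoidAlgebra.mem_supported] at hf ⊢
    intro v hv
    obtain ⟨w, hw, rfl⟩ := Finset.mem_image.1 (Finsupp.mapDomain_support hv)
    have := hf hw
    simp only [Set.mem_ofPred_eq, FreeMonoid.length] at this ⊢
    simpa using this

/-- The homogeneous components are finite-dimensional, so that traces on them are meaningful. -/
instance finite_inf_homogeneousPart {n : ℕ} (M : Subrepresentation (permRep n)) (k : ℕ) :
    Module.Finite ℚ (M ⊓ homogeneousPart n k).toSubmodule := by
  have hfin : ({w : FreeMonoid (Fin n) | w.length = k}).Finite :=
    List.finite_length_eq (Fin n) k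
  have : Finite {w : FreeMonoid (Fin n) | w.length = k} := hfin
  have h1 : Module.Finite ℚ (homogeneousPart n k).toSubmodule :=
    Module.Finite.equiv
      (MonoidAlgebra.supportedEquivFinsupp (R := ℚ) {w : FreeMonoid (Fin n) | w.length = k}).symm
  exact Submodule.finiteDimensional_of_le
    (S₂ := (homogeneousPart n k).toSubmodule) (fun _ hx => hx.2)

/-! ### The graded Frobenius characteristic -/

/-- The graded character `σ ↦ ∑_k tr(σ | M_k) q^k` of a (homogeneous) subrepresentation `M` of
`ℚ⟨X_n⟩`, where `M_k` is the homogeneous component of degree `k` of `M`. -/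
def gradedCharacter {n : ℕ} (M : Subrepresentation (permRep n)) (σ : Equiv.Perm (Fin n)) :
    PowerSeries ℚ :=
  PowerSeries.mk fun k => (M ⊓ homogeneousPart n k).toRepresentation.character σ

/-- The graded Frobenius characteristic `(1/n!) ∑_{σ ∈ 𝔖_n} χ_q^M(σ) p_{λ(σ)}`, where `λ(σ)` is the
cycle type of `σ` (fixed points included) and `χ_q^M` is the graded character of `M`. -/
def gradedFrob {n : ℕ} (M : Subrepresentation (permRep n)) : SymFn :=
  ((n.factorial : ℚ)⁻¹) •
    ∑ σ : Equiv.Perm (Fin n), MvPolynomial.C (gradedCharacter M σ) * pPart σ.partition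

end NCHarmonics

end

/-!
The Hausdorff derivatives are commuting derivations, so `ℚ⟨X_n⟩` is filtered by the order of the
iterated derivatives that annihilate an element. Passing to the derivatives of order `d` identifies
the `d`-th graded piece with `S^d(ℚ^n) ⊗ A'_n`: surjectivity is the existence of simultaneous
antiderivatives. Taking traces of a permutation `σ` with `m` fixed points and cycle lengths `c`, and
using that `ℚ⟨X_n⟩` and `S(ℚ^n)` have graded characters `1 / (1 - m q)` and `∏_c 1 / (1 - q^c)`, one
finds that `A'_n` has graded character `∏_c (1 - q^c) / (1 - m q)` at `σ`.

The product over `c` is what `p_k ↦ (1 - q^k) p_k` does to `p_{λ(σ)}`. The other factor is expanded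
by telescoping, as `1 / (1 - m q) = ∑_d m (m - 1) ⋯ (m - d + 1) q^d / {q;q}_d`, and the falling
factorial is the eigenvalue of `p₁^d ∂^d` at `p_{λ(σ)}`, where `∂ = ∂/∂p₁`. Averaging over `σ` turns
`p_{λ(σ)}` into `h_n`, and `∂ h_m = h_{m-1}` gives `p₁^d ∂^d h_n = h_1^d h_{n-d}`.
-/

noncomputable section

namespace NCHarmonics

section Trace

variable {R M N P ι : Type*} [CommRing R] [AddCommGroup M] [Module R M]

theorem trace_of_apply_basis [Fintype ι] [DecidableEq ι] (b : Module.Basis ι R M) (τ : ι → ι)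
    {f : Module.End R M} (hf : ∀ i, f (b i) = b (τ i)) :
    LinearMap.trace R M f = Fintype.card (Function.fixedPoints τ) := by
  rw [LinearMap.trace_eq_matrix_trace R b, Matrix.trace]
  simp only [Matrix.diag_apply, LinearMap.toMatrix_apply, hf, Module.Basis.repr_self,
    Finsupp.single_apply, Finset.sum_boole]
  rw [← Fintype.card_subtype]
  rfl

variable [Module.Free R M] [Module.Finite R M]
  [AddCommGroup N] [Module R N] [Module.Free R N] [Module.Finite R N]
  [AddCommGroup P] [Module R P] [Module.Free R P] [Module.Finite R P]

theorem trace_eq_add_of_exact {i : M →ₗ[R] N} {π : N →ₗ[R] P} {a : Module.End R M}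
    {b : Module.End R N} {c : Module.End R P} (hi : Function.Injective i)
    (hπ : Function.Surjective π) (hexact : Function.Exact i π) (hab : b ∘ₗ i = i ∘ₗ a)
    (hbc : π ∘ₗ b = c ∘ₗ π) :
    LinearMap.trace R N b = LinearMap.trace R M a + LinearMap.trace R P c := by
  obtain ⟨e, rfl, rfl⟩ := ((hexact.split_tfae hi hπ).out 0 2 :
    (∃ s, π ∘ₗ s = LinearMap.id) ↔ _).1 (Module.projective_lifting_property π LinearMap.id hπ)
  let r := LinearMap.fst R M P ∘ₗ e.toLinearMap
  let s := e.symm.toLinearMap ∘ₗ LinearMap.inr R M P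
  have hsplit : b = (e.symm.toLinearMap ∘ₗ LinearMap.inl R M P ∘ₗ a) ∘ₗ r +
      (b ∘ₗ s) ∘ₗ LinearMap.snd R M P ∘ₗ e.toLinearMap := by
    rw [← LinearMap.comp_assoc a, ← hab]
    ext v
    simp [r, s, ← map_add]
  conv_lhs => rw [hsplit]
  rw [map_add, LinearMap.trace_comp_comm', LinearMap.trace_comp_comm' _ (b ∘ₗ s),
    ← LinearMap.comp_assoc s, hbc]
  congr 2 <;> ext <;> simp [r, s]

theorem trace_pi_comp_proj [Fintype ι] [DecidableEq ι] (τ : ι → ι) (a : Module.End R M) :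
    LinearMap.trace R (ι → M) (LinearMap.pi fun j => a ∘ₗ LinearMap.proj (τ j)) =
      Fintype.card (Function.fixedPoints τ) * LinearMap.trace R M a := by
  let b := Module.Free.chooseBasis R M
  have hdiag (j : ι) : ∑ x, LinearMap.toMatrix (Pi.basis fun _ : ι => b)
      (Pi.basis fun _ => b) (LinearMap.pi fun j => a ∘ₗ LinearMap.proj (τ j)) ⟨j, x⟩ ⟨j, x⟩ =
        if τ j = j then LinearMap.trace R M a else 0 := by
    rw [LinearMap.trace_eq_matrix_trace R b, Matrix.trace]
    split_ifs with hj <;> simp [LinearMap.toMatrix_apply, hj]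
  rw [LinearMap.trace_eq_matrix_trace R (Pi.basis fun _ : ι => b), Matrix.trace,
    Fintype.sum_sigma]
  simp only [Matrix.diag_apply, hdiag, Finset.sum_ite, Finset.sum_const_zero, add_zero,
    Finset.sum_const, nsmul_eq_mul]
  rw [← Fintype.card_subtype]
  rfl

end Trace

section HausdorffDerivative

variable {n : ℕ}

theorem deleteSum_mul (x : Fin n) (v w : FreeMonoid (Fin n)) :
    deleteSum x (v * w) =
      deleteSum x v * MonoidAlgebra.single w 1 + MonoidAlgebra.single v 1 * deleteSum x w := by
  simp only [deleteSum, FreeMonoid.toList_mul, List.length_append, Finset.sum_range_add,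
    Finset.sum_mul, Finset.mul_sum, ite_mul, mul_ite, zero_mul, mul_zero,
    MonoidAlgebra.single_mul_single, mul_one]
  congr 1
  · refine Finset.sum_congr rfl fun i hi => ?_
    have hi := Finset.mem_range.1 hi
    simp only [List.getElem?_append_left hi, List.eraseIdx_append_of_lt_length hi,
      FreeMonoid.ofList_append, FreeMonoid.ofList_toList]
  · refine Finset.sum_congr rfl fun i _ => ?_
    simp only [List.getElem?_append_right (Nat.le_add_right _ _),
      List.eraseIdx_append_of_length_le (Nat.le_add_right _ _), add_tsub_cancel_left,
      FreeMonoid.ofList_append, FreeMonoid.ofList_toList]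

theorem hausdorff_mul (x : Fin n) (a b : NCPoly n) :
    hausdorff x (a * b) = hausdorff x a * b + a * hausdorff x b := by
  induction a using MonoidAlgebra.induction_on with
  | of v =>
    induction b using MonoidAlgebra.induction_on with
    | of w =>
      simp only [MonoidAlgebra.of_apply, MonoidAlgebra.single_mul_single, mul_one,
        hausdorff_single, deleteSum_mul]
    | add b c hb hc => simp only [mul_add, map_add, hb, hc]; abel
    | smul r b hb => simp only [mul_smul_comm, map_smul, hb, smul_add]
  | add a c ha hc => simp only [add_mul, map_add, ha, hc]; abel
  | smul r a ha => simp only [smul_mul_assoc, map_smul, ha, smul_add]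

theorem hausdorff_one (x : Fin n) : hausdorff x 1 = 0 := by
  simp [MonoidAlgebra.one_def, hausdorff_single, deleteSum]

theorem hausdorff_single_of (x y : Fin n) :
    hausdorff x (MonoidAlgebra.single (FreeMonoid.of y) 1) = if y = x then 1 else 0 := by
  simp [hausdorff_single, deleteSum, MonoidAlgebra.one_def]

theorem hausdorff_commute (x y : Fin n) : Commute (hausdorff x) (hausdorff y) := by
  refine LinearMap.ext fun a => ?_
  simp only [Module.End.mul_apply]
  induction a using MonoidAlgebra.induction_on with
  | of w =>
    induction w using FreeMonoid.inductionOn with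
    | one => simp [hausdorff_one, ← MonoidAlgebra.one_def]
    | of z => simp [hausdorff_single_of, apply_ite, hausdorff_one]
    | mul v w hv hw =>
      simp only [map_mul, hausdorff_mul, map_add, hv, hw]
      abel
  | add a b ha hb => simp only [map_add, ha, hb]
  | smul r a ha => simp only [map_smul, ha]

end HausdorffDerivative

section IteratedDerivative

variable {n : ℕ}

theorem mem_derivedEnveloping {a : NCPoly n} :
    a ∈ (derivedEnveloping n).toSubmodule ↔ ∀ x, hausdorff x a = 0 := by
  simp [derivedEnveloping]

/-- The iterated Hausdorff derivative `∂_β = ∏_{x ∈ β} ∂_x` along a multiset `β` of variables; the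
order of the factors is irrelevant because the derivatives commute. -/
def iterHausdorff (β : Multiset (Fin n)) : Module.End ℚ (NCPoly n) :=
  (β.map hausdorff).noncommProd <| by
    rintro f hf g hg -
    obtain ⟨x, -, rfl⟩ := Multiset.mem_map.1 hf
    obtain ⟨y, -, rfl⟩ := Multiset.mem_map.1 hg
    exact hausdorff_commute x y

@[simp]
theorem iterHausdorff_zero (a : NCPoly n) : iterHausdorff 0 a = a := by
  simp [iterHausdorff]

theorem iterHausdorff_cons (x : Fin n) (β : Multiset (Fin n)) (a : NCPoly n) :
    iterHausdorff (x ::ₘ β) a = hausdorff x (iterHausdorff β a) := by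
  simp only [iterHausdorff, Multiset.map_cons, Multiset.noncommProd_cons, Module.End.mul_apply]

theorem iterHausdorff_cons' (x : Fin n) (β : Multiset (Fin n)) (a : NCPoly n) :
    iterHausdorff (x ::ₘ β) a = iterHausdorff β (hausdorff x a) := by
  simp only [iterHausdorff, Multiset.map_cons, Multiset.noncommProd_cons', Module.End.mul_apply]

theorem iterHausdorff_map_permRep (β : Multiset (Fin n)) (σ : Equiv.Perm (Fin n)) (a : NCPoly n) :
    iterHausdorff (β.map σ) (permRep n σ a) = permRep n σ (iterHausdorff β a) := by
  induction β using Multiset.induction with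
  | empty => simp
  | cons x β ih => rw [Multiset.map_cons, iterHausdorff_cons, ih, hausdorff_permRep,
      iterHausdorff_cons]

/-- A simultaneous antiderivative of order `d` of a family `f` of elements of `A'_n` indexed by the
multisets of `d` variables, in the sense of `iterHausdorff_antiderivative`. Unfolding the recursion
it is `1/d! ∑ x₁ ⋯ x_d f {x₁, …, x_d}`, the sum being over all words of length `d`. -/
def antiderivative : (d : ℕ) → (Sym (Fin n) d → NCPoly n) → NCPoly n
  | 0, f => f Sym.nil
  | d + 1, f => ((d + 1 : ℕ) : ℚ)⁻¹ •
      ∑ x, MonoidAlgebra.single (FreeMonoid.of x) 1 * antiderivative d fun β => f (x ::ₛ β)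

theorem sum_single_mul_antiderivative (d : ℕ) (f : Sym (Fin n) (d + 1) → NCPoly n) :
    ∑ x, MonoidAlgebra.single (FreeMonoid.of x) 1 * antiderivative d (fun β => f (x ::ₛ β)) =
      ((d + 1 : ℕ) : ℚ) • antiderivative (d + 1) f := by
  rw [antiderivative, smul_inv_smul₀ (by positivity)]

theorem smul_hausdorff_antiderivative (y : Fin n) (d : ℕ) (f : Sym (Fin n) (d + 1) → NCPoly n) :
    ((d + 1 : ℕ) : ℚ) • hausdorff y (antiderivative (d + 1) f) =
      antiderivative d (fun β => f (y ::ₛ β)) +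
        ∑ x, MonoidAlgebra.single (FreeMonoid.of x) 1 *
          hausdorff y (antiderivative d fun β => f (x ::ₛ β)) := by
  rw [← map_smul, ← sum_single_mul_antiderivative]
  simp [hausdorff_mul, hausdorff_single_of, Finset.sum_add_distrib]

theorem hausdorff_antiderivative (y : Fin n) {d : ℕ} {f : Sym (Fin n) (d + 1) → NCPoly n}
    (hf : ∀ β, f β ∈ (derivedEnveloping n).toSubmodule) :
    hausdorff y (antiderivative (d + 1) f) = antiderivative d fun β => f (y ::ₛ β) := by
  have hd (d : ℕ) : ((d + 1 : ℕ) : ℚ) ≠ 0 := by positivity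
  rw [← smul_right_inj (hd d), smul_hausdorff_antiderivative]
  induction d with
  | zero => simp [antiderivative, mem_derivedEnveloping.1 (hf _)]
  | succ d ih =>
    have hcomm (x : Fin n) : hausdorff y (antiderivative (d + 1) fun β => f (x ::ₛ β)) =
        antiderivative d fun β => f (y ::ₛ x ::ₛ β) := by
      rw [← smul_right_inj (hd d), smul_hausdorff_antiderivative, ih fun β => hf _]
      simp only [Sym.cons_swap y x]
    simp only [hcomm]
    rw [sum_single_mul_antiderivative d fun β => f (y ::ₛ β)]
    push_cast
    module

theorem iterHausdorff_antiderivative {d : ℕ} {f : Sym (Fin n) d → NCPoly n}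
    (hf : ∀ β, f β ∈ (derivedEnveloping n).toSubmodule) (β : Sym (Fin n) d) :
    iterHausdorff (β : Multiset (Fin n)) (antiderivative d f) = f β := by
  induction d with
  | zero => simp [antiderivative, Sym.eq_nil_of_card_zero β]
  | succ d ih =>
    obtain ⟨y, γ, rfl⟩ := Sym.exists_eq_cons_of_succ β
    rw [Sym.coe_cons, iterHausdorff_cons', hausdorff_antiderivative y hf, ih fun γ => hf _]

end IteratedDerivative

section Degree

variable {n k : ℕ}

theorem homogeneousPart_toSubmodule_eq_span (n k : ℕ) : (homogeneousPart n k).toSubmodule =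
    Submodule.span ℚ ((fun w => MonoidAlgebra.single w 1) '' {w | w.length = k}) :=
  MonoidAlgebra.supported_eq_span_single ..

theorem single_mem_homogeneousPart {w : FreeMonoid (Fin n)} (hw : w.length = k) :
    MonoidAlgebra.single w 1 ∈ (homogeneousPart n k).toSubmodule := by
  rw [homogeneousPart_toSubmodule_eq_span]
  exact Submodule.subset_span ⟨w, hw, rfl⟩

theorem map_mem_of_mem_homogeneousPart {f : Module.End ℚ (NCPoly n)} {N : Submodule ℚ (NCPoly n)}
    (hf : ∀ w : FreeMonoid (Fin n), w.length = k → f (MonoidAlgebra.single w 1) ∈ N)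
    {a : NCPoly n} (ha : a ∈ (homogeneousPart n k).toSubmodule) : f a ∈ N := by
  suffices (homogeneousPart n k).toSubmodule ≤ N.comap f from this ha
  rw [homogeneousPart_toSubmodule_eq_span, Submodule.span_le]
  rintro _ ⟨w, hw, rfl⟩
  exact hf w hw

theorem single_mul_mem_homogeneousPart (w : FreeMonoid (Fin n)) {a : NCPoly n}
    (ha : a ∈ (homogeneousPart n k).toSubmodule) :
    MonoidAlgebra.single w 1 * a ∈ (homogeneousPart n (w.length + k)).toSubmodule := by
  refine map_mem_of_mem_homogeneousPart (f := LinearMap.mulLeft ℚ _) (fun v hv => ?_) ha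
  rw [LinearMap.mulLeft_apply, MonoidAlgebra.single_mul_single, one_mul]
  exact single_mem_homogeneousPart (by rw [FreeMonoid.length_mul, hv])

theorem hausdorff_mem_homogeneousPart (x : Fin n) {a : NCPoly n}
    (ha : a ∈ (homogeneousPart n (k + 1)).toSubmodule) :
    hausdorff x a ∈ (homogeneousPart n k).toSubmodule := by
  refine map_mem_of_mem_homogeneousPart (fun w hw => ?_) ha
  rw [hausdorff_single, deleteSum]
  refine Submodule.sum_mem _ fun i hi => ?_
  split_ifs
  · refine single_mem_homogeneousPart ?_
    change w.toList.length = k + 1 at hw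
    change (w.toList.eraseIdx i).length = k
    rw [List.length_eraseIdx_of_lt (Finset.mem_range.1 hi), hw, Nat.add_sub_cancel]
  · exact Submodule.zero_mem _

theorem hausdorff_eq_zero_of_mem_homogeneousPart_zero (x : Fin n) {a : NCPoly n}
    (ha : a ∈ (homogeneousPart n 0).toSubmodule) : hausdorff x a = 0 := by
  refine (Submodule.mem_bot ℚ).1 (map_mem_of_mem_homogeneousPart (fun w hw => ?_) ha)
  rw [FreeMonoid.length_eq_zero.1 hw, ← MonoidAlgebra.one_def, hausdorff_one, Submodule.mem_bot]

theorem iterHausdorff_mem_homogeneousPart (β : Multiset (Fin n)) {a : NCPoly n}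
    (ha : a ∈ (homogeneousPart n (k + β.card)).toSubmodule) :
    iterHausdorff β a ∈ (homogeneousPart n k).toSubmodule := by
  induction β using Multiset.induction generalizing a with
  | empty => simpa using ha
  | cons x β ih =>
    rw [iterHausdorff_cons']
    exact ih (hausdorff_mem_homogeneousPart x (by rwa [Multiset.card_cons, ← add_assoc] at ha))

theorem antiderivative_mem_homogeneousPart {d : ℕ} {f : Sym (Fin n) d → NCPoly n}
    (hf : ∀ β, f β ∈ (homogeneousPart n k).toSubmodule) :
    antiderivative d f ∈ (homogeneousPart n (k + d)).toSubmodule := by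
  induction d with
  | zero => exact hf _
  | succ d ih =>
    refine Submodule.smul_mem _ _ (Submodule.sum_mem _ fun x _ => ?_)
    have := single_mul_mem_homogeneousPart (FreeMonoid.of x) (ih fun β => hf (x ::ₛ β))
    rwa [FreeMonoid.length_of, add_comm, add_assoc] at this

end Degree

section Filtration

variable {n : ℕ}

/-- The filtration of `ℚ⟨X_n⟩` by the order of the iterated derivatives that annihilate: the `d`-th
step consists of the elements all of whose iterated derivatives of order `d` vanish, so that it is
`0` for `d = 0` and `A'_n` for `d = 1`. -/
def derivFiltration (n d : ℕ) : Subrepresentation (permRep n) where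
  toSubmodule := ⨅ β : Sym (Fin n) d, LinearMap.ker (iterHausdorff (β : Multiset (Fin n)))
  apply_mem_toSubmodule σ a ha := by
    simp only [Submodule.mem_iInf, LinearMap.mem_ker] at ha ⊢
    intro β
    have := iterHausdorff_map_permRep (β.map (σ⁻¹ : Equiv.Perm (Fin n)) : Sym (Fin n) d) σ a
    rw [ha, map_zero, Sym.coe_map, Multiset.map_map] at this
    simpa using this

theorem mem_derivFiltration {d : ℕ} {a : NCPoly n} : a ∈ (derivFiltration n d).toSubmodule ↔
    ∀ β : Sym (Fin n) d, iterHausdorff (β : Multiset (Fin n)) a = 0 := by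
  simp [derivFiltration]

theorem mem_derivFiltration_succ {d : ℕ} {a : NCPoly n} :
    a ∈ (derivFiltration n (d + 1)).toSubmodule ↔ ∀ β : Sym (Fin n) d,
      iterHausdorff (β : Multiset (Fin n)) a ∈ (derivedEnveloping n).toSubmodule := by
  simp only [mem_derivFiltration, mem_derivedEnveloping, ← iterHausdorff_cons]
  refine ⟨fun h β x => h (x ::ₛ β), fun h γ => ?_⟩
  obtain ⟨x, β, rfl⟩ := Sym.exists_eq_cons_of_succ γ
  exact h β x

theorem derivFiltration_zero (n : ℕ) : derivFiltration n 0 = ⊥ := by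
  refine Subrepresentation.toSubmodule_injective (eq_bot_iff.2 fun a ha => ?_)
  simpa using mem_derivFiltration.1 ha Sym.nil

theorem derivFiltration_mono (n : ℕ) : Monotone (derivFiltration n) := by
  refine monotone_nat_of_le_succ fun d a ha => mem_derivFiltration_succ.2 fun β => ?_
  rw [mem_derivFiltration.1 ha]
  exact Submodule.zero_mem _

theorem homogeneousPart_le_derivFiltration (n k : ℕ) :
    homogeneousPart n k ≤ derivFiltration n (k + 1) := by
  refine fun a ha => mem_derivFiltration_succ.2 fun β => mem_derivedEnveloping.2 fun x => ?_
  refine hausdorff_eq_zero_of_mem_homogeneousPart_zero x (iterHausdorff_mem_homogeneousPart _ ?_)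
  rw [Sym.card_coe, zero_add]
  exact ha

/-- The symbol map, which sends an element of the `(d + 1)`-st step of the filtration to the family
of its derivatives of order `d`; its kernel is the `d`-th step. -/
def symbol (n d j : ℕ) : (derivFiltration n (d + 1) ⊓ homogeneousPart n (j + d)).toSubmodule →ₗ[ℚ]
    (Sym (Fin n) d → (derivedEnveloping n ⊓ homogeneousPart n j).toSubmodule) :=
  LinearMap.pi fun β => (iterHausdorff (β : Multiset (Fin n))).restrict fun _ ha =>
    ⟨mem_derivFiltration_succ.1 ha.1 β,
      iterHausdorff_mem_homogeneousPart _ (by rw [Sym.card_coe]; exact ha.2)⟩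

theorem symbol_surjective (n d j : ℕ) : Function.Surjective (symbol n d j) := by
  intro f
  have hderiv := iterHausdorff_antiderivative fun β => (f β).2.1
  refine ⟨⟨antiderivative d fun β => f β, mem_derivFiltration_succ.2 fun β => ?_,
    antiderivative_mem_homogeneousPart fun β => (f β).2.2⟩,
    funext fun β => Subtype.ext (hderiv β)⟩
  rw [hderiv]
  exact (f β).2.1

theorem symbol_eq_zero_iff {d j : ℕ}
    {a : (derivFiltration n (d + 1) ⊓ homogeneousPart n (j + d)).toSubmodule} :
    symbol n d j a = 0 ↔ (a : NCPoly n) ∈ (derivFiltration n d).toSubmodule := by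
  rw [mem_derivFiltration, funext_iff]
  exact forall_congr' fun β => Subtype.ext_iff

end Filtration

section Character

/-- The number of multisets of `d` elements of `α` that are fixed by `σ`, i.e. the trace of `σ` on
the symmetric power `S^d` of the permutation representation on `α`. -/
def fixedSymCount {α : Type*} [Fintype α] [DecidableEq α] (σ : Equiv.Perm α) (d : ℕ) : ℕ :=
  Fintype.card (Function.fixedPoints fun β : Sym α d => β.map σ)

theorem fixedSymCount_inv {α : Type*} [Fintype α] [DecidableEq α] (σ : Equiv.Perm α) (d : ℕ) :
    fixedSymCount σ⁻¹ d = fixedSymCount σ d := by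
  refine Fintype.card_congr (Equiv.subtypeEquivRight fun β => ?_)
  exact ((Sym.equivCongr σ).symm_apply_eq (x := β) (y := β)).trans eq_comm

variable {n : ℕ}

theorem character_derivFiltration_succ (n d j : ℕ) (σ : Equiv.Perm (Fin n)) :
    (derivFiltration n (d + 1) ⊓ homogeneousPart n (j + d)).toRepresentation.character σ =
      (derivFiltration n d ⊓ homogeneousPart n (j + d)).toRepresentation.character σ +
        fixedSymCount σ d *
          (derivedEnveloping n ⊓ homogeneousPart n j).toRepresentation.character σ := by
  have hle : (derivFiltration n d ⊓ homogeneousPart n (j + d)).toSubmodule ≤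
      (derivFiltration n (d + 1) ⊓ homogeneousPart n (j + d)).toSubmodule :=
    fun _ ha => ⟨derivFiltration_mono n d.le_succ ha.1, ha.2⟩
  have hexact : Function.Exact (Submodule.inclusion hle) (symbol n d j) := fun a =>
    symbol_eq_zero_iff.trans ⟨fun ha => ⟨⟨a, ha, a.2.2⟩, rfl⟩, by rintro ⟨b, rfl⟩; exact b.2.1⟩
  simp only [Representation.character]
  rw [← fixedSymCount_inv, fixedSymCount, ← trace_pi_comp_proj]
  refine trace_eq_add_of_exact (Submodule.inclusion_injective hle) (symbol_surjective n d j)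
    hexact rfl (LinearMap.ext fun a => funext fun β => Subtype.ext ?_)
  change iterHausdorff (β : Multiset (Fin n)) (permRep n σ a) =
    permRep n σ (iterHausdorff (β.map (σ⁻¹ : Equiv.Perm (Fin n)) : Sym (Fin n) d) (a : NCPoly n))
  rw [← iterHausdorff_map_permRep, Sym.coe_map, Multiset.map_map]
  simp

theorem character_derivFiltration (n d k : ℕ) (hd : d ≤ k + 1) (σ : Equiv.Perm (Fin n)) :
    (derivFiltration n d ⊓ homogeneousPart n k).toRepresentation.character σ =
      ∑ e ∈ Finset.range d, fixedSymCount σ e *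
        (derivedEnveloping n ⊓ homogeneousPart n (k - e)).toRepresentation.character σ := by
  induction d with
  | zero =>
    rw [derivFiltration_zero, bot_inf_eq, Finset.sum_range_zero, Representation.character]
    have : Subsingleton (⊥ : Subrepresentation (permRep n)).toSubmodule :=
      inferInstanceAs (Subsingleton (⊥ : Submodule ℚ (NCPoly n)))
    rw [Subsingleton.elim ((⊥ : Subrepresentation (permRep n)).toRepresentation σ) 0, map_zero]
  | succ d ih =>
    obtain ⟨j, rfl⟩ := Nat.exists_eq_add_of_le' (Nat.le_of_succ_le_succ hd)
    rw [character_derivFiltration_succ, ih (by omega), Finset.sum_range_succ, Nat.add_sub_cancel]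

theorem mk_fixedSymCount_mul_gradedCharacter (σ : Equiv.Perm (Fin n)) :
    (PowerSeries.mk fun d => (fixedSymCount σ d : ℚ)) * gradedCharacter (derivedEnveloping n) σ =
      PowerSeries.mk fun k => (homogeneousPart n k).toRepresentation.character σ := by
  ext k
  rw [PowerSeries.coeff_mul, Finset.Nat.sum_antidiagonal_eq_sum_range_succ_mk,
    PowerSeries.coeff_mk, ← inf_eq_right.2 (homogeneousPart_le_derivFiltration n k),
    character_derivFiltration n (k + 1) k le_rfl]
  simp [gradedCharacter]

theorem permRep_single (σ : Equiv.Perm (Fin n)) (w : FreeMonoid (Fin n)) (r : ℚ) :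
    permRep n σ (MonoidAlgebra.single w r) = MonoidAlgebra.single (FreeMonoid.map σ w) r := by
  simp [permRep]

/-- The basis of the homogeneous component of degree `k` that consists of the words of length `k`,
indexed by the functions `Fin k → Fin n`. -/
def wordBasis (n k : ℕ) :
    Module.Basis (Fin k → Fin n) ℚ (homogeneousPart n k).toSubmodule :=
  .reindex (.ofRepr (MonoidAlgebra.supportedEquivFinsupp (R := ℚ)
    {w : FreeMonoid (Fin n) | w.length = k})) (Equiv.vectorEquivFin (Fin n) k)

theorem wordBasis_repr_apply {k : ℕ} (a : (homogeneousPart n k).toSubmodule) (g : Fin k → Fin n) :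
    (wordBasis n k).repr a g = (a : NCPoly n).coeff (FreeMonoid.ofList (List.ofFn g)) :=
  congrArg (a : NCPoly n).coeff (List.Vector.toList_ofFn g)

theorem coe_wordBasis {k : ℕ} (g : Fin k → Fin n) :
    (wordBasis n k g : NCPoly n) = MonoidAlgebra.single (FreeMonoid.ofList (List.ofFn g)) 1 := by
  suffices wordBasis n k g = ⟨MonoidAlgebra.single (FreeMonoid.ofList (List.ofFn g)) 1,
    single_mem_homogeneousPart List.length_ofFn⟩ from congrArg Subtype.val this
  refine (wordBasis n k).repr.injective (Finsupp.ext fun g' => ?_)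
  rw [Module.Basis.repr_self, wordBasis_repr_apply]
  exact (Finsupp.single_apply_left (FreeMonoid.ofList.injective.comp List.ofFn_injective) ..).symm

theorem character_homogeneousPart (k : ℕ) (σ : Equiv.Perm (Fin n)) :
    (homogeneousPart n k).toRepresentation.character σ =
      Fintype.card (Function.fixedPoints σ) ^ k := by
  have hbasis (g : Fin k → Fin n) :
      (homogeneousPart n k).toRepresentation σ (wordBasis n k g) = wordBasis n k (σ ∘ g) := by
    refine Subtype.ext ?_
    change permRep n σ (wordBasis n k g) = _
    rw [coe_wordBasis, coe_wordBasis, permRep_single, ← FreeMonoid.ofList_map, List.map_ofFn]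
  have hfixed : Fintype.card (Function.fixedPoints fun g : Fin k → Fin n => σ ∘ g) =
      Fintype.card (Function.fixedPoints σ) ^ k := by
    rw [← Fintype.card_fin k, ← Fintype.card_fun, Fintype.card_fin]
    exact Fintype.card_congr ((Equiv.subtypeEquivRight fun g => funext_iff).trans
      (Equiv.subtypePiEquivPi (p := fun _ x => σ x = x)))
  rw [Representation.character, trace_of_apply_basis (wordBasis n k) _ hbasis, hfixed,
    Nat.cast_pow]

end Character

section FixedMultisets

open PowerSeries

variable {α ι : Type*} [Fintype ι] [DecidableEq ι] {π : α → ι}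

theorem sum_comp_eq_sum_card_fiber_mul [Fintype α] (f : ι → ℕ) :
    ∑ x, f (π x) = ∑ i, Fintype.card {x // π x = i} * f i := by
  rw [← Finset.sum_fiberwise Finset.univ π]
  refine Finset.sum_congr rfl fun i _ => ?_
  rw [Finset.sum_congr rfl fun x hx => congrArg f (Finset.mem_filter.1 hx).2, Finset.sum_const,
    smul_eq_mul, Fintype.card_subtype]

variable [DecidableEq α] {σ : Equiv.Perm α}

theorem sym_map_eq_self_iff {d : ℕ} {β : Sym α d} :
    β.map σ = β ↔
      ∀ x y, σ.SameCycle x y → (β : Multiset α).count x = (β : Multiset α).count y := by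
  have hcount (x : α) : (β.map σ : Multiset α).count (σ x) = (β : Multiset α).count x := by
    rw [Sym.coe_map, Multiset.count_map_eq_count' _ _ σ.injective]
  constructor
  · rintro hβ x _ ⟨k, rfl⟩
    have hstep (y : α) : (β : Multiset α).count (σ y) = (β : Multiset α).count y := by
      simpa only [hβ] using hcount y
    induction k with
    | zero => simp
    | succ k ih => rw [add_comm, zpow_one_add, Equiv.Perm.mul_apply, hstep, ih]
    | pred k ih =>
      rw [ih, ← hstep ((σ ^ (-(k : ℤ) - 1)) x), ← Equiv.Perm.mul_apply, ← zpow_one_add,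
        add_sub_cancel]
  · refine fun hβ => Sym.coe_injective (Multiset.ext.2 fun y => ?_)
    obtain ⟨x, rfl⟩ := σ.surjective y
    rw [hcount, hβ x (σ x) ⟨1, rfl⟩]

variable [Fintype α]

theorem fixedSymCount_eq_card_finsuppAntidiag (hπ : π.Surjective)
    (hσ : ∀ x y, π x = π y ↔ σ.SameCycle x y) (d : ℕ) :
    fixedSymCount σ d = ((Finset.univ.finsuppAntidiag d).filter fun l : ι →₀ ℕ =>
      ∀ i, Fintype.card {x // π x = i} ∣ l i).card := by
  set c : ι → ℕ := fun i => Fintype.card {x // π x = i}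
  have hc (i : ι) : 0 < c i := Fintype.card_pos_iff.2 (nonempty_subtype.2 (hπ i))
  have hsum {l : ι →₀ ℕ}
      (hl : l ∈ (Finset.univ.finsuppAntidiag d).filter fun l => ∀ i, c i ∣ l i) :
      ∑ x, l (π x) / c (π x) = d := by
    obtain ⟨hl, hdvd⟩ := Finset.mem_filter.1 hl
    rw [sum_comp_eq_sum_card_fiber_mul fun i => l i / c i, ← (Finset.mem_finsuppAntidiag.1 hl).1]
    exact Finset.sum_congr rfl fun i _ => Nat.mul_div_cancel' (hdvd i)
  rw [fixedSymCount, Fintype.card_subtype]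
  refine (Finset.card_bij (fun l hl => (Sym.equivNatSumOfFintype α d).symm ⟨_, hsum hl⟩)
    (fun l hl => ?_) (fun l hl l' hl' hll' => ?_) fun β hβ => ?_).symm
  · refine Finset.mem_filter.2 ⟨Finset.mem_univ _, sym_map_eq_self_iff.2 fun x y hxy => ?_⟩
    simp only [← Sym.coe_equivNatSumOfFintype_apply_apply, Equiv.apply_symm_apply,
      (hσ x y).2 hxy]
  · have hdiv (x : α) : l (π x) / c (π x) = l' (π x) / c (π x) :=
      congrFun (Subtype.ext_iff.1 ((Sym.equivNatSumOfFintype α d).symm.injective hll')) x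
    refine Finsupp.ext fun i => ?_
    obtain ⟨x, rfl⟩ := hπ i
    rw [← Nat.div_mul_cancel ((Finset.mem_filter.1 hl).2 (π x)),
      ← Nat.div_mul_cancel ((Finset.mem_filter.1 hl').2 (π x)), hdiv]
  · have hfix := sym_map_eq_self_iff.1 (Finset.mem_filter.1 hβ).2
    obtain ⟨m, hm⟩ : ∃ m : ι → ℕ, ∀ x, m (π x) = (β : Multiset α).count x :=
      ⟨fun i => (β : Multiset α).count (hπ i).choose, fun x =>
        hfix _ _ ((hσ _ _).1 (hπ (π x)).choose_spec)⟩
    refine ⟨Finsupp.equivFunOnFinite.symm fun i => c i * m i, Finset.mem_filter.2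
      ⟨Finset.mem_finsuppAntidiag.2 ⟨?_, Finset.subset_univ _⟩, fun i => dvd_mul_right _ _⟩, ?_⟩
    · change ∑ i, c i * m i = d
      rw [← sum_comp_eq_sum_card_fiber_mul, ← (Sym.equivNatSumOfFintype α d β).2]
      exact Finset.sum_congr rfl fun x _ => hm x
    · refine (Equiv.symm_apply_eq _).2 (Subtype.ext (funext fun x => ?_))
      exact (Nat.mul_div_cancel_left _ (hc _)).trans (hm x)

theorem one_sub_X_pow_mul_mk_dvd (R : Type*) [CommRing R] {m : ℕ} (hm : m ≠ 0) :
    (1 - X ^ m : R⟦X⟧) * mk (fun k => if m ∣ k then 1 else 0) = 1 := by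
  have hexpand : expand m hm (mk 1 : R⟦X⟧) = mk fun k => if m ∣ k then 1 else 0 := by
    ext k
    simp [coeff_expand]
  simpa [hexpand, mul_comm] using congrArg (expand m hm) (mk_one_mul_one_sub_eq_one R)

theorem prod_one_sub_X_pow_mul_mk_fixedSymCount_of_fibers (R : Type*) [CommRing R]
    (hπ : π.Surjective) (hσ : ∀ x y, π x = π y ↔ σ.SameCycle x y) :
    (∏ i, (1 - X ^ Fintype.card {x // π x = i})) * mk (fun d => (fixedSymCount σ d : R)) = 1 := by
  have hmk : mk (fun d => (fixedSymCount σ d : R)) =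
      ∏ i, mk fun k => if Fintype.card {x // π x = i} ∣ k then 1 else 0 := by
    ext d
    simp [coeff_prod, Finset.prod_ite_zero, fixedSymCount_eq_card_finsuppAntidiag hπ hσ]
  have hcard (i : ι) : Fintype.card {x // π x = i} ≠ 0 :=
    (Fintype.card_pos_iff.2 (nonempty_subtype.2 (hπ i))).ne'
  rw [hmk, ← Finset.prod_mul_distrib]
  exact Finset.prod_eq_one fun i _ => one_sub_X_pow_mul_mk_dvd R (hcard i)

end FixedMultisets

section CycleIndex

open PowerSeries

variable {α : Type*} [Fintype α] [DecidableEq α]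

/-- The cycle of `σ` that contains `x`, fixed points being counted as cycles of length one. -/
def cycleIndex (σ : Equiv.Perm α) (x : α) : σ.cycleFactorsFinset ⊕ Function.fixedPoints σ :=
  if hx : σ x = x then .inr ⟨x, hx⟩
  else .inl ⟨σ.cycleOf x, Equiv.Perm.cycleOf_mem_cycleFactorsFinset_iff.2
    (Equiv.Perm.mem_support.2 hx)⟩

variable {σ : Equiv.Perm α}

theorem cycleIndex_eq_inl_iff {x : α} {c : σ.cycleFactorsFinset} :
    cycleIndex σ x = .inl c ↔ x ∈ (c : Equiv.Perm α).support := by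
  by_cases hx : σ x = x
  · have : x ∉ (c : Equiv.Perm α).support := fun h =>
      Equiv.Perm.mem_support.1 (Equiv.Perm.mem_cycleFactorsFinset_support_le c.2 h) hx
    simp [cycleIndex, hx, this]
  · rw [← Equiv.Perm.eq_cycleOf_of_mem_cycleFactorsFinset_iff σ c c.2]
    simp [cycleIndex, hx, Subtype.ext_iff, eq_comm]

theorem cycleIndex_eq_inr_iff {x : α} {y : Function.fixedPoints σ} :
    cycleIndex σ x = .inr y ↔ x = y := by
  by_cases hx : σ x = x
  · simp [cycleIndex, hx, Subtype.ext_iff]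
  · have : x ≠ y := fun h => hx (h ▸ y.2)
    simp [cycleIndex, hx, this]

theorem cycleIndex_surjective : (cycleIndex σ).Surjective := by
  rintro (c | y)
  · obtain ⟨x, hx⟩ := (Equiv.Perm.mem_cycleFactorsFinset_iff.1 c.2).1.nonempty_support
    exact ⟨x, cycleIndex_eq_inl_iff.2 hx⟩
  · exact ⟨y, cycleIndex_eq_inr_iff.2 rfl⟩

theorem cycleIndex_eq_iff {x y : α} : cycleIndex σ x = cycleIndex σ y ↔ σ.SameCycle x y := by
  rcases h : cycleIndex σ y with c | z
  · have hy := cycleIndex_eq_inl_iff.1 h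
    rw [cycleIndex_eq_inl_iff, Equiv.Perm.cycle_is_cycleOf hy c.2,
      Equiv.Perm.mem_support_cycleOf_iff, Equiv.Perm.sameCycle_comm]
    exact and_iff_left (Equiv.Perm.mem_cycleFactorsFinset_support_le c.2 hy)
  · obtain rfl := cycleIndex_eq_inr_iff.1 h
    rw [cycleIndex_eq_inr_iff]
    exact ⟨fun hxz => hxz ▸ .refl σ x, fun hxz => (hxz.symm.eq_of_left z.2).symm⟩

theorem map_card_fiber_cycleIndex (σ : Equiv.Perm α) :
    (Finset.univ.val.map fun i => Fintype.card {x // cycleIndex σ x = i}) = σ.partition.parts := by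
  have hcycle (c : σ.cycleFactorsFinset) : Fintype.card {x // cycleIndex σ x = .inl c} =
      (c : Equiv.Perm α).support.card := by
    simp only [cycleIndex_eq_inl_iff, Fintype.card_coe]
  have hfixed (y : Function.fixedPoints σ) : Fintype.card {x // cycleIndex σ x = .inr y} = 1 := by
    simp only [cycleIndex_eq_inr_iff, Fintype.card_unique]
  rw [← Finset.univ_disjSum_univ, Finset.val_disjSum, Multiset.map_disjSum,
    Equiv.Perm.parts_partition, Multiset.map_congr rfl fun c _ => hcycle c,
    Multiset.map_congr rfl fun y _ => hfixed y, Multiset.map_const', Finset.card_val,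
    Finset.card_univ, Equiv.Perm.card_fixedPoints, Equiv.Perm.sum_cycleType]
  congr 1
  exact Multiset.attach_map_val' σ.cycleFactorsFinset.1 fun c => c.support.card

theorem prod_one_sub_X_pow_mul_mk_fixedSymCount (R : Type*) [CommRing R] (σ : Equiv.Perm α) :
    (σ.partition.parts.map fun c => (1 - X ^ c : R⟦X⟧)).prod *
      mk (fun d => (fixedSymCount σ d : R)) = 1 := by
  rw [← map_card_fiber_cycleIndex, Multiset.map_map]
  exact prod_one_sub_X_pow_mul_mk_fixedSymCount_of_fibers R cycleIndex_surjective
    fun _ _ => cycleIndex_eq_iff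

end CycleIndex

section GradedCharacter

open PowerSeries

theorem one_sub_C_mul_X_mul_mk_pow {R : Type*} [CommRing R] (a : R) :
    (1 - C a * X : R⟦X⟧) * mk (fun k => a ^ k) = 1 := by
  have h := congrArg (rescale a) (mk_one_mul_one_sub_eq_one R)
  rw [map_mul, rescale_mk, map_sub, map_one, rescale_X, mul_comm] at h
  simpa only [Pi.one_apply, mul_one] using h

theorem one_sub_mul_gradedCharacter {n : ℕ} (σ : Equiv.Perm (Fin n)) :
    (1 - (Fintype.card (Function.fixedPoints σ) : ℚ⟦X⟧) * X) *
        gradedCharacter (derivedEnveloping n) σ =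
      (σ.partition.parts.map fun c => (1 - X ^ c : ℚ⟦X⟧)).prod := by
  have hgeom := one_sub_C_mul_X_mul_mk_pow (Fintype.card (Function.fixedPoints σ) : ℚ)
  have hchar := mk_fixedSymCount_mul_gradedCharacter σ
  simp only [character_homogeneousPart] at hchar
  rw [← hchar, map_natCast] at hgeom
  linear_combination (σ.partition.parts.map fun c => (1 - X ^ c : ℚ⟦X⟧)).prod * hgeom -
    (1 - (Fintype.card (Function.fixedPoints σ) : ℚ⟦X⟧) * X) *
      gradedCharacter (derivedEnveloping n) σ * prod_one_sub_X_pow_mul_mk_fixedSymCount ℚ σ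

theorem constantCoeff_braceQ (d : ℕ) : constantCoeff (braceQ d) = 1 := by
  simp [braceQ, map_prod]

theorem one_sub_mul_inv_braceQ_succ (d : ℕ) :
    (1 - ((d + 1 : ℕ) : ℚ⟦X⟧) * X) * (braceQ (d + 1))⁻¹ = (braceQ d)⁻¹ := by
  have hne (d : ℕ) : constantCoeff (braceQ d) ≠ 0 := constantCoeff_braceQ d ▸ one_ne_zero
  have hsucc : (1 - ((d + 1 : ℕ) : ℚ⟦X⟧) * X) * braceQ d = braceQ (d + 1) := by
    rw [braceQ, braceQ, Finset.prod_Icc_succ_top (by omega), mul_comm]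
  rw [PowerSeries.eq_inv_iff_mul_eq_one (hne d), mul_right_comm, hsucc,
    PowerSeries.mul_inv_cancel _ (hne (d + 1))]

theorem cast_descFactorial_succ {R : Type*} [CommRing R] (m d : ℕ) :
    (m.descFactorial (d + 1) : R) = (m - d) * m.descFactorial d := by
  rw [← descPochhammer_eval_eq_descFactorial, descPochhammer_succ_eval,
    descPochhammer_eval_eq_descFactorial, mul_comm]

theorem one_sub_mul_sum_descFactorial_braceQ (m n : ℕ) :
    (1 - (m : ℚ⟦X⟧) * X) * ∑ d ∈ Finset.range (n + 1),
        (m.descFactorial d : ℚ⟦X⟧) * (X ^ d * (braceQ d)⁻¹) =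
      1 - (m.descFactorial (n + 1) : ℚ⟦X⟧) * (X ^ (n + 1) * (braceQ n)⁻¹) := by
  induction n with
  | zero => simp [braceQ]
  | succ n ih =>
    rw [Finset.sum_range_succ, mul_add, ih, cast_descFactorial_succ m (n + 1),
      ← one_sub_mul_inv_braceQ_succ n]
    push_cast
    ring

theorem gradedCharacter_derivedEnveloping {n : ℕ} (σ : Equiv.Perm (Fin n)) :
    gradedCharacter (derivedEnveloping n) σ =
      (∑ d ∈ Finset.range (n + 1),
        ((Fintype.card (Function.fixedPoints σ)).descFactorial d : ℚ⟦X⟧) *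
          (X ^ d * (braceQ d)⁻¹)) *
        (σ.partition.parts.map fun c => (1 - X ^ c : ℚ⟦X⟧)).prod := by
  have hlt : Fintype.card (Function.fixedPoints σ) < n + 1 :=
    Nat.lt_succ_of_le ((Fintype.card_subtype_le _).trans_eq (Fintype.card_fin n))
  have hinv := one_sub_mul_sum_descFactorial_braceQ (Fintype.card (Function.fixedPoints σ)) n
  rw [Nat.descFactorial_of_lt hlt, Nat.cast_zero, zero_mul, sub_zero] at hinv
  rw [← one_sub_mul_gradedCharacter]
  linear_combination -gradedCharacter (derivedEnveloping n) σ * hinv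

end GradedCharacter

section PowerSumDerivative

open MvPolynomial

theorem pow_mul_iterate_derivation {R A : Type*} [CommRing R] [CommRing A] [Algebra R A]
    (D : Derivation R A A) {x f : A} {m : ℕ} (hx : D x = 1) (hf : x * D f = m * f) (d : ℕ) :
    x ^ d * D^[d] f = m.descFactorial d * f := by
  induction d with
  | zero => simp
  | succ d ih =>
    have hD : x ^ d * D^[d + 1] f + d * x ^ (d - 1) * D^[d] f = m.descFactorial d * D f := by
      have := congrArg D ih
      simp only [D.leibniz, D.leibniz_pow, D.map_natCast, hx, smul_eq_mul, nsmul_eq_mul,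
        mul_one, mul_zero, add_zero] at this
      rw [Function.iterate_succ_apply', ← this, mul_comm (D^[d] f)]
    have hpow : (d : A) * x ^ (d - 1) * x = d * x ^ d := by
      rcases d with - | d
      · simp
      · rw [Nat.add_sub_cancel, mul_assoc, pow_succ]
    rw [cast_descFactorial_succ]
    linear_combination x * hD - D^[d] f * hpow + m.descFactorial d * hf - d * ih

theorem pderiv_one_p {k : ℕ} (hk : 0 < k) : pderiv 1 (p k) = if k = 1 then 1 else 0 := by
  rw [p, pderiv_X, Pi.single_apply]
  refine if_congr ?_ rfl rfl
  rw [← PNat.coe_inj, Nat.toPNat'_coe, if_pos hk, PNat.one_coe]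

theorem p_one_mul_pderiv_prod_map_p {s : Multiset ℕ} (hs : ∀ k ∈ s, 0 < k) :
    p 1 * pderiv 1 (s.map p).prod = s.count 1 * (s.map p).prod := by
  induction s using Multiset.induction with
  | empty => simp
  | cons k s ih =>
    have ih := ih fun i hi => hs i (Multiset.mem_cons_of_mem hi)
    rw [Multiset.map_cons, Multiset.prod_cons, pderiv_mul, pderiv_one_p
      (hs k (Multiset.mem_cons_self k s)), Multiset.count_cons]
    rcases eq_or_ne k 1 with rfl | hk
    · rw [if_pos rfl, if_pos rfl, Nat.cast_add, Nat.cast_one]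
      linear_combination p 1 * ih
    · rw [if_neg hk, if_neg hk.symm, add_zero]
      linear_combination p k * ih

theorem h_zero : h 0 = 1 := by
  rw [h, Fintype.sum_unique, Unique.default_eq (Nat.Partition.indiscrete 0)]
  simp [z, pPart]

theorem pderiv_h_succ (m : ℕ) : pderiv 1 (h (m + 1)) = h m := by
  induction m using Nat.strong_induction_on with
  | _ m ih =>
    have hterm (k : ℕ) (hk : k ∈ Finset.Icc 1 (m + 1)) : pderiv 1 (p k * h (m + 1 - k)) =
        (if k = 1 then h (m + 1 - k) else 0) + p k * pderiv 1 (h (m + 1 - k)) := by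
      rw [pderiv_mul, pderiv_one_p (Finset.mem_Icc.1 hk).1, ite_mul, one_mul, zero_mul]
    have hih : ∑ k ∈ Finset.Icc 1 (m + 1), p k * pderiv 1 (h (m + 1 - k)) = (m : ℚ) • h m := by
      rw [Finset.sum_Icc_succ_top (by omega), Nat.sub_self, h_zero, pderiv_one, mul_zero, add_zero,
        newton_h]
      refine Finset.sum_congr rfl fun k hk => ?_
      obtain ⟨hk, hkm⟩ := Finset.mem_Icc.1 hk
      rw [Nat.sub_add_comm hkm, ih (m - k) (by omega)]
    have hnewton := congrArg (pderiv 1) (newton_h (m + 1))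
    rw [map_sum, Finset.sum_congr rfl hterm, Finset.sum_add_distrib, hih, Finset.sum_ite_eq',
      if_pos (by simp), map_rat_smul, Nat.add_sub_cancel] at hnewton
    have hne : ((m + 1 : ℕ) : ℚ) ≠ 0 := Nat.cast_ne_zero.2 m.succ_ne_zero
    refine smul_right_injective SymFn hne (hnewton.trans ?_)
    dsimp only
    rw [Nat.cast_succ, add_smul, one_smul, add_comm]

theorem iterate_pderiv_h {n d : ℕ} (hd : d ≤ n) : (pderiv 1)^[d] (h n) = h (n - d) := by
  induction d with
  | zero => simp
  | succ d ih =>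
    rw [Function.iterate_succ_apply', ih (by omega), (by omega : n - d = n - (d + 1) + 1),
      pderiv_h_succ]

theorem h_one : h 1 = p 1 := by
  rw [h, Fintype.sum_unique, Unique.default_eq (Nat.Partition.indiscrete 1)]
  simp [z, pPart]

theorem hList_cons_replicate_one {n d : ℕ} (hd : d ≤ n) :
    hList ((n - d) :: List.replicate d 1) = p 1 ^ d * (pderiv 1)^[d] (h n) := by
  rw [hList, List.map_cons, List.map_replicate, List.prod_cons, List.prod_replicate, h_one,
    mul_comm, iterate_pderiv_h hd]

end PowerSumDerivative

section CycleType

theorem parts_eq_filter_add_replicate {m : ℕ} (μ : m.Partition) :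
    μ.parts = μ.parts.filter (2 ≤ ·) + Multiset.replicate (μ.parts.count 1) 1 := by
  rw [← Multiset.filter_eq']
  conv_lhs => rw [← Multiset.filter_add_not (2 ≤ ·) μ.parts]
  refine congrArg _ (Multiset.filter_congr fun i hi => ?_)
  have := μ.parts_pos hi
  omega

theorem sum_filter_add_count_one {m : ℕ} (μ : m.Partition) :
    (μ.parts.filter (2 ≤ ·)).sum + μ.parts.count 1 = m := by
  conv_rhs => rw [← μ.parts_sum, parts_eq_filter_add_replicate μ]
  simp

theorem z_eq_factorial_mul {m : ℕ} (μ : m.Partition) :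
    z μ = (μ.parts.count 1).factorial * (μ.parts.filter (2 ≤ ·)).prod *
      ∏ i ∈ (μ.parts.filter (2 ≤ ·)).toFinset,
        ((μ.parts.filter (2 ≤ ·)).count i).factorial := by
  have hprod : μ.parts.prod = (μ.parts.filter (2 ≤ ·)).prod := by
    conv_lhs => rw [parts_eq_filter_add_replicate μ]
    simp
  have hfact : ∏ i ∈ μ.parts.toFinset, (μ.parts.count i).factorial =
      (μ.parts.count 1).factorial * ∏ i ∈ (μ.parts.filter (2 ≤ ·)).toFinset,
        ((μ.parts.filter (2 ≤ ·)).count i).factorial := by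
    have hone : 1 ∉ (μ.parts.filter (2 ≤ ·)).toFinset := by simp
    have hinsert : insert 1 μ.parts.toFinset = insert 1 (μ.parts.filter (2 ≤ ·)).toFinset := by
      ext i
      have hpos : i ∈ μ.parts → 0 < i := fun hi => μ.parts_pos hi
      simp only [Finset.mem_insert, Multiset.mem_toFinset, Multiset.mem_filter]
      grind
    rw [← Finset.prod_insert_of_eq_one_if_notMem (a := 1) fun h => by simp_all, hinsert,
      Finset.prod_insert hone]
    refine congrArg _ (Finset.prod_congr rfl fun i hi => ?_)
    rw [Multiset.count_filter_of_pos (Multiset.mem_filter.1 (Multiset.mem_toFinset.1 hi)).2]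
  rw [z, Finset.prod_mul_distrib, ← Finset.prod_multiset_count, hprod, hfact]
  ring

variable {α : Type*} [Fintype α] [DecidableEq α]

theorem partition_eq_iff_cycleType_eq {σ : Equiv.Perm α} {μ : (Fintype.card α).Partition} :
    σ.partition = μ ↔ σ.cycleType = μ.parts.filter (2 ≤ ·) := by
  rw [← σ.filter_parts_partition_eq_cycleType]
  refine ⟨fun hσ => hσ ▸ rfl, fun hσ => Nat.Partition.ext ?_⟩
  have hcount : σ.partition.parts.count 1 = μ.parts.count 1 := by
    have hsum := sum_filter_add_count_one σ.partition
    rw [hσ] at hsum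
    exact add_left_cancel (hsum.trans (sum_filter_add_count_one μ).symm)
  rw [parts_eq_filter_add_replicate σ.partition, parts_eq_filter_add_replicate μ, hσ, hcount]

theorem card_filter_partition_eq_mul_z (μ : (Fintype.card α).Partition) :
    (Finset.univ.filter fun σ : Equiv.Perm α => σ.partition = μ).card * z μ =
      (Fintype.card α).factorial := by
  have hsum := sum_filter_add_count_one μ
  have hcount : μ.parts.count 1 = Fintype.card α - (μ.parts.filter (2 ≤ ·)).sum := by omega
  rw [z_eq_factorial_mul, hcount]
  simp only [partition_eq_iff_cycleType_eq]
  rw [Equiv.Perm.card_of_cycleType_mul_eq,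
    if_pos ⟨by omega, fun i hi => (Multiset.mem_filter.1 hi).2⟩]

theorem inv_factorial_smul_sum_pPart_partition :
    ((Fintype.card α).factorial : ℚ)⁻¹ • ∑ σ : Equiv.Perm α, pPart σ.partition =
      h (Fintype.card α) := by
  rw [inv_smul_eq_iff₀ (Nat.cast_ne_zero.2 (Nat.factorial_ne_zero _)), h, Finset.smul_sum,
    ← Finset.sum_fiberwise Finset.univ Equiv.Perm.partition]
  refine Finset.sum_congr rfl fun μ _ => ?_
  rw [Finset.sum_congr rfl fun σ hσ => congrArg pPart (Finset.mem_filter.1 hσ).2, Finset.sum_const,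
    ← card_filter_partition_eq_mul_z μ, smul_smul, Nat.cast_mul,
    mul_inv_cancel_right₀ (z_ne_zero μ), Nat.cast_smul_eq_nsmul]

theorem count_one_parts_partition (σ : Equiv.Perm α) :
    σ.partition.parts.count 1 = Fintype.card (Function.fixedPoints σ) := by
  have hnot : 1 ∉ σ.cycleType := fun h => (Equiv.Perm.one_lt_of_mem_cycleType h).ne rfl
  rw [Equiv.Perm.parts_partition, Multiset.count_add, Multiset.count_replicate_self,
    Multiset.count_eq_zero_of_notMem hnot, zero_add, Equiv.Perm.card_fixedPoints,
    Equiv.Perm.sum_cycleType]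

end CycleType

section HookOperator

open PowerSeries

theorem plethOneSubQ_pPart {m : ℕ} (μ : m.Partition) :
    plethOneSubQ (pPart μ) =
      MvPolynomial.C (μ.parts.map fun c => (1 - X ^ c : ℚ⟦X⟧)).prod * pPart μ := by
  rw [pPart, map_multiset_prod, map_multiset_prod, Multiset.map_map, Multiset.map_map,
    ← Multiset.prod_map_mul]
  refine congrArg Multiset.prod (Multiset.map_congr rfl fun c hc => ?_)
  have hc : 0 < c := μ.parts_pos hc
  simp [plethOneSubQ, p, hc]

/-- The operator `f ↦ (p₁^d ∂^d f/∂p₁^d)[X(1-q)]` on symmetric functions. It has the power sums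
`p_μ` as eigenvectors and sends `h_n` to `h_{(n-d,1^d)}[X(1-q)]`. -/
def hookOperator (d : ℕ) : SymFn →ₗ[ℚ⟦X⟧] SymFn :=
  plethOneSubQ.toLinearMap ∘ₗ LinearMap.mulLeft ℚ⟦X⟧ (p 1 ^ d) ∘ₗ
    (MvPolynomial.pderiv 1 : Derivation ℚ⟦X⟧ SymFn SymFn).toLinearMap ^ d

theorem hookOperator_apply (d : ℕ) (f : SymFn) :
    hookOperator d f = plethOneSubQ (p 1 ^ d * (MvPolynomial.pderiv 1)^[d] f) := by
  simp [hookOperator, Module.End.pow_apply]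

theorem hookOperator_pPart {m : ℕ} (d : ℕ) (μ : m.Partition) :
    hookOperator d (pPart μ) = MvPolynomial.C (((μ.parts.count 1).descFactorial d : ℚ⟦X⟧) *
      (μ.parts.map fun c => (1 - X ^ c : ℚ⟦X⟧)).prod) * pPart μ := by
  have heigen : p 1 * MvPolynomial.pderiv 1 (pPart μ) = μ.parts.count 1 * pPart μ :=
    p_one_mul_pderiv_prod_map_p fun _ => μ.parts_pos
  rw [hookOperator_apply, pow_mul_iterate_derivation _ ((pderiv_one_p one_pos).trans (if_pos rfl))
    heigen, map_mul, map_natCast, plethOneSubQ_pPart, map_mul, map_natCast, mul_assoc]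

theorem hookOperator_h {n d : ℕ} (hd : d ≤ n) :
    hookOperator d (h n) = plethOneSubQ (hList ((n - d) :: List.replicate d 1)) := by
  rw [hookOperator_apply, hList_cons_replicate_one hd]

theorem C_gradedCharacter_mul_pPart {n : ℕ} (σ : Equiv.Perm (Fin n)) :
    MvPolynomial.C (gradedCharacter (derivedEnveloping n) σ) * pPart σ.partition =
      ∑ d ∈ Finset.range (n + 1),
        MvPolynomial.C (X ^ d * (braceQ d)⁻¹) * hookOperator d (pPart σ.partition) := by
  rw [gradedCharacter_derivedEnveloping, Finset.sum_mul, map_sum, Finset.sum_mul]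
  refine Finset.sum_congr rfl fun d _ => ?_
  rw [hookOperator_pPart, count_one_parts_partition]
  simp only [map_mul]
  ring

end HookOperator

end NCHarmonics

end

theorem mainTheorem3 (n : ℕ) :
    NCHarmonics.gradedFrob (NCHarmonics.derivedEnveloping n) =
      ∑ d ∈ Finset.range (n + 1),
        MvPolynomial.C (PowerSeries.X ^ d * (NCHarmonics.braceQ d)⁻¹) *
          NCHarmonics.plethOneSubQ (NCHarmonics.hList ((n - d) :: List.replicate d 1)) := by
  have haverage : (n.factorial : ℚ)⁻¹ • ∑ σ : Equiv.Perm (Fin n), NCHarmonics.pPart σ.partition =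
      NCHarmonics.h n := by
    simpa using NCHarmonics.inv_factorial_smul_sum_pPart_partition (α := Fin n)
  rw [NCHarmonics.gradedFrob, Finset.sum_congr rfl fun σ _ =>
    NCHarmonics.C_gradedCharacter_mul_pPart σ, Finset.sum_comm, Finset.smul_sum]
  refine Finset.sum_congr rfl fun d hd => ?_
  rw [← NCHarmonics.hookOperator_h (Nat.lt_succ_iff.1 (Finset.mem_range.1 hd)), ← haverage,
    map_rat_smul, map_sum, ← Finset.mul_sum, mul_smul_comm]
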